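/- Let $x_1,\dots,x_n\in\mathbb R^d$ and $y\in\mathbb R^n$ be training data. For $W=(w_1,\dots,w_m)\in(\mathbb R^d)^m$ and $a\in\mathbb R^m$ let $$f(W,a,x)=\frac1{\sqrt m}\sum_{r=1}^m a_r\,\sigma(w_r^\top x),\qquad \sigma(z)=\max(z,0).$$ A gradient flow on the first layer (for the loss $\frac12\sum_{i=1}^n(f(W,a,x_i)-y_i)^2$, with $a$ fixed) is a curve $W:[0,\infty)\to(\mathbb R^d)^m$, absolutely continuous on every interval $[0,T]$, such that for almost every $t>0$ there are numbers $\xi_{ir}\in\partial\sigma(w_r(t)^\top x_i)$ with $$\frac{d w_r(t)}{dt}=-\frac1{\sqrt m}\sum_{i=1}^n\bigl(f(W(t),a,x_i)-y_i\bigr)\,a_r\,\xi_{ir}\,x_i\qquad(1\le r\le m);$$ here $\partial\sigma(z)$ is $\{1\}$ for $z>0$, $\{0\}$ for $z<0$ and $[0,1]$ for $z=0$ (so $\xi_{ir}=\mathbb I\{w_r(t)^\top x_i\ge0\}$ is allowed). Write $u(t)=(f(W(t),a,x_i))_{i=1}^n\in\mathbb R^n$. Let $\mathbf H^\infty\in\mathbb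 R^{n\times n}$ be the matrix with entries $$\mathbf H^\infty_{ij}=\mathbb E_{w\sim N(0,I)}\left[x_i^\top x_j\,\mathbb I\{w^\top x_i\ge0,\ w^\top x_j\ge0\}\right],$$ and $\lambda_0=\lambda_{\min}(\mathbf H^\infty)$ its least eigenvalue. **Theorem (Convergence Rate of Gradient Flow).** For every $C$ there is a constant $K>0$, depending only on $C$, such that the following holds for all $n\ge1$, $d$, $m$, all data $(x_i,y_i)_{i=1}^n$ and all $\delta>0$. Suppose that $\lambda_0>0$, that $\|x_i\|_2=1$ and $|y_i|\le C$ for all $i$, and that $$m\ge K\,\frac{n^6}{\lambda_0^4\,\delta^3}.$$ Let $w_1(0),\dots,w_m(0)\sim N(0,I)$ and $a_1,\dots,a_m\sim\mathrm{unif}\{-1,1\}$ all be independent. Then with probability at least $1-\delta$ over this initialization, every gradient flow $W$ on the first layer that starts at $W(0)=(w_1(0),\dots,w_m(0))$ satisfies, for all $t\ge0$, $$\|u(t)-y\|_2^2\le\exp(-\lambda_0t)\,\|u(0)-y\|_2^2 .$$ -/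

import Mathlib

open MeasureTheory ProbabilityTheory Set

namespace TwoLayerReLU

noncomputable section

/-- The ReLU activation `z ↦ max z 0`. -/
def relu (z : ℝ) : ℝ := max z 0

/-- The (convex) subdifferential of ReLU at `z`: it is `{1}` for `z > 0`, `{0}` for `z < 0`, and
`[0, 1]` for `z = 0`. -/
def reluSubdifferential (z : ℝ) : Set ℝ :=
  {s | 0 ≤ s ∧ s ≤ 1 ∧ (0 < z → s = 1) ∧ (z < 0 → s = 0)}

/-- The network `f(W, a, v) = (1 / √m) ∑ r, a r * relu ⟨W r, v⟩`. -/
def network {d m : ℕ} (W : Fin m → EuclideanSpace ℝ (Fin d)) (a : Fin m → ℝ)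
    (v : EuclideanSpace ℝ (Fin d)) : ℝ :=
  (1 / Real.sqrt m) * ∑ r, a r * relu (inner ℝ (W r) v)

/-- The vector `(f(W, a, x 1), …, f(W, a, x n))` of predictions on the training inputs. -/
def prediction {n d m : ℕ} (x : Fin n → EuclideanSpace ℝ (Fin d)) (a : Fin m → ℝ)
    (W : Fin m → EuclideanSpace ℝ (Fin d)) : EuclideanSpace ℝ (Fin n) :=
  WithLp.toLp 2 fun i => network W a (x i)

/-- The gradient formula with respect to the first layer of the loss
`(1 / 2) ∑ i, (f(W, a, x i) - y i) ^ 2`, in which the derivative of ReLU at `⟨W r, x i⟩` is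
replaced by the number `ξ i r`; its `r`-th entry is
`(1 / √m) ∑ i, (f(W, a, x i) - y i) a r (ξ i r) (x i)`. -/
def gradientFormula {n d m : ℕ} (x : Fin n → EuclideanSpace ℝ (Fin d))
    (y : EuclideanSpace ℝ (Fin n)) (a : Fin m → ℝ) (W : Fin m → EuclideanSpace ℝ (Fin d))
    (ξ : Fin n → Fin m → ℝ) (r : Fin m) : EuclideanSpace ℝ (Fin d) :=
  (1 / Real.sqrt m) • ∑ i, ((network W a (x i) - y i) * a r * ξ i r) • x i

/-- The set-valued gradient of the loss with respect to the first layer: all values of the gradient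
formula with `ξ i r` in the subdifferential of ReLU at `⟨W r, x i⟩`. It is a singleton, the usual
gradient, unless some `⟨W r, x i⟩` vanishes. -/
def lossSubgradient {n d m : ℕ} (x : Fin n → EuclideanSpace ℝ (Fin d))
    (y : EuclideanSpace ℝ (Fin n)) (a : Fin m → ℝ) (W : Fin m → EuclideanSpace ℝ (Fin d)) :
    Set (Fin m → EuclideanSpace ℝ (Fin d)) :=
  {G | ∃ ξ : Fin n → Fin m → ℝ,
    (∀ i r, ξ i r ∈ reluSubdifferential (inner ℝ (W r) (x i))) ∧ G = gradientFormula x y a W ξ}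

/-- The gradient formula with the indicators `𝟙 {⟨W r, x i⟩ ≥ 0}` is one of the subgradients, so
that the differential inclusion below covers the differential equation written with them. -/
theorem indicator_mem_lossSubgradient {n d m : ℕ} (x : Fin n → EuclideanSpace ℝ (Fin d))
    (y : EuclideanSpace ℝ (Fin n)) (a : Fin m → ℝ) (W : Fin m → EuclideanSpace ℝ (Fin d)) :
    gradientFormula x y a W
        (fun i r => (Ici (0 : ℝ)).indicator (fun _ => (1 : ℝ)) (inner ℝ (W r) (x i))) ∈
      lossSubgradient x y a W := by
  refine ⟨_, fun i r => ?_, rfl⟩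
  by_cases h : 0 ≤ (inner ℝ (W r) (x i) : ℝ)
  · simp [reluSubdifferential, h, not_lt.mpr h]
  · simp [reluSubdifferential, h, le_of_not_ge h]

/-- `W` is a gradient flow of the loss in the first layer, on the time interval `[0, ∞)`, with the
second layer `a` fixed: each weight vector is absolutely continuous on every `[0, T]`, and
`dW/dt ∈ -∂L(W)` for almost every `t > 0`. -/
structure IsGradientFlow {n d m : ℕ} (x : Fin n → EuclideanSpace ℝ (Fin d))
    (y : EuclideanSpace ℝ (Fin n)) (a : Fin m → ℝ)
    (W : ℝ → Fin m → EuclideanSpace ℝ (Fin d)) : Prop where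
  absolutelyContinuous : ∀ r, ∀ T : ℝ, 0 ≤ T →
    AbsolutelyContinuousOnInterval (fun t => W t r) 0 T
  inclusion : ∀ᵐ t ∂(volume.restrict (Ioi (0 : ℝ))),
    ∃ G ∈ lossSubgradient x y a (W t), ∀ r, HasDerivAt (fun s => W s r) (-G r) t

/-- The Gram matrix `H^∞`, with entries
`𝔼_{w ∼ N(0, I)} [⟨x i, x j⟩ 𝟙 {⟨w, x i⟩ ≥ 0, ⟨w, x j⟩ ≥ 0}]`. -/
def gramInfinity {n d : ℕ} (x : Fin n → EuclideanSpace ℝ (Fin d)) : Matrix (Fin n) (Fin n) ℝ :=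
  Matrix.of fun i j => ∫ w, {w : EuclideanSpace ℝ (Fin d) |
      0 ≤ (inner ℝ w (x i) : ℝ) ∧ 0 ≤ (inner ℝ w (x j) : ℝ)}.indicator
    (fun _ => (inner ℝ (x i) (x j) : ℝ)) w ∂(stdGaussian (EuclideanSpace ℝ (Fin d)))

/-- The least eigenvalue of a real symmetric matrix of positive size (and `0` for the empty
matrix). -/
def leastEigenvalue {n : ℕ} (A : Matrix (Fin n) (Fin n) ℝ) : ℝ := sInf (spectrum ℝ A)

/-- The law of the random initialization `(W(0), a)`: all the weight vectors and output weights are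
independent, the weight vectors with law `N(0, I)`, the output weights uniform on `{-1, 1}`. -/
def initLaw (d m : ℕ) : Measure ((Fin m → EuclideanSpace ℝ (Fin d)) × (Fin m → ℝ)) :=
  (Measure.pi fun _ : Fin m => stdGaussian (EuclideanSpace ℝ (Fin d))).prod
    (Measure.pi fun _ : Fin m => uniformOn ({-1, 1} : Set ℝ))

end

end TwoLayerReLU

/-! ### Absolutely continuous functions. -/

open Filter Topology

/-! Write `λ` for the least eigenvalue of `H^∞` and `e = u - y`. For almost every `t`, `e' = -H e`,
where `H` is the `activationGram` of the current activations: the output signs cancel because `a r ^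
2 = 1`, and the value of `ξ` at a kink is irrelevant (`hasDerivAt_relu_comp`).

Two facts support each other. While `H ≥ λ/2` as a quadratic form, `exp (λ t) ‖e‖²` cannot increase,
so each neuron has speed at most `√(n/m) exp (-λ t/2) ‖e 0‖` and total displacement at most `(2/λ)
√(n/m) ‖e 0‖` (`IsGradientFlow.norm_sub_le`). Conversely, while all weights stay within `R` of their
start, only pairs with `|⟪w_r(0), x_i⟫| ≤ R` can change activation; if these are few, `H ≥ λ/2`
persists (`quadraticForm_activationGram_ge`). If the displacement bound is below `R`, there is no
first time of leaving the ball (`IsGradientFlow.norm_prediction_sub_sq_le_of_init`).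

Moment bounds and Markov's inequality make the initialization suitable (`initLaw_good_compl_le`):
the mean squared Frobenius error of `H(0)` is at most `n²/m`, at most `n m R` near-boundary pairs
are expected, and the random signs give mean at most `1` to each squared prediction. The second
bound leads to `R` of order `λδ/n²`; the squared displacement has order `n²/(m δ λ²)`. Comparing it
with `R²` produces the width `n⁶/(λ⁴δ³)`. -/

theorem AbsolutelyContinuousOnInterval.lipschitzWith_comp {X Y : Type*} [PseudoMetricSpace X]
    [PseudoMetricSpace Y] {f : ℝ → X} {g : X → Y} {K : NNReal} {a b : ℝ}
    (hf : AbsolutelyContinuousOnInterval f a b) (hg : LipschitzWith K g) :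
    AbsolutelyContinuousOnInterval (fun t => g (f t)) a b := by
  apply squeeze_zero (fun t ↦ ?_) (fun t ↦ ?_) (by simpa using Tendsto.const_mul (K : ℝ) hf)
  · exact Finset.sum_nonneg fun i _ ↦ dist_nonneg
  · rw [Finset.mul_sum]
    exact Finset.sum_le_sum fun i _ ↦ hg.dist_le_mul _ _

theorem AbsolutelyContinuousOnInterval.fun_finsetSum {ι F : Type*} [SeminormedAddCommGroup F]
    {f : ι → ℝ → F} {a b : ℝ} (s : Finset ι)
    (hf : ∀ i ∈ s, AbsolutelyContinuousOnInterval (f i) a b) :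
    AbsolutelyContinuousOnInterval (fun t => ∑ i ∈ s, f i t) a b := by
  classical
  induction s using Finset.induction_on with
  | empty =>
    simpa using (LipschitzWith.const (0 : F)).lipschitzOnWith.absolutelyContinuousOnInterval
  | insert i s hi ih =>
    simp only [Finset.sum_insert hi]
    exact (hf i (Finset.mem_insert_self i s)).fun_add
      (ih fun j hj => hf j (Finset.mem_insert_of_mem hj))

/-- The fundamental theorem of calculus for absolutely continuous functions. It serves in place of
Grönwall's inequality, since the flow is differentiable only almost everywhere. -/
theorem AbsolutelyContinuousOnInterval.le_of_ae_hasDerivAt_nonpos {f : ℝ → ℝ} {a b : ℝ}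
    (hab : a ≤ b) (hf : AbsolutelyContinuousOnInterval f a b)
    (h : ∀ᵐ t, t ∈ Ioo a b → ∃ f', HasDerivAt f f' t ∧ f' ≤ 0) : f b ≤ f a := by
  have h1 := hf.integral_deriv_eq_sub
  have h2 : ∫ t in a..b, deriv f t ≤ 0 := by
    rw [intervalIntegral.integral_of_le hab, integral_Ioc_eq_integral_Ioo]
    refine integral_nonpos_of_ae ?_
    rw [EventuallyLE, ae_restrict_iff' measurableSet_Ioo]
    filter_upwards [h] with t ht htm
    obtain ⟨f', hf', hle⟩ := ht htm
    simpa [hf'.deriv] using hle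
  linarith

/-! ### ReLU chain rule and perturbation of activation Gram matrices. -/

namespace TwoLayerReLU

theorem lipschitzWith_relu : LipschitzWith 1 relu :=
  LipschitzWith.id.max_const 0

/-- Only `z t = 0` is delicate. There `relu ∘ z` and `relu ∘ z - z` are nonnegative and vanish at
`t`, so both have derivative `0`; hence `z' = 0` and every subgradient `s` gives the same product.
-/
theorem hasDerivAt_relu_comp {z : ℝ → ℝ} {z' t s : ℝ} (hz : HasDerivAt z z' t)
    (hr : DifferentiableAt ℝ (fun τ => relu (z τ)) t) (hs : s ∈ reluSubdifferential (z t)) :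
    HasDerivAt (fun τ => relu (z τ)) (s * z') t := by
  obtain ⟨-, -, hpos, hneg⟩ := hs
  rcases lt_trichotomy (z t) 0 with h | h | h
  · rw [hneg h, zero_mul]
    refine (hasDerivAt_const t (0 : ℝ)).congr_of_eventuallyEq ?_
    filter_upwards [hz.continuousAt.eventually (gt_mem_nhds h)] with τ hτ
    exact max_eq_right hτ.le
  · have hmin : IsLocalMin (fun τ => relu (z τ)) t :=
      Eventually.of_forall fun τ => by simp [relu, h]
    have h0 := hmin.hasDerivAt_eq_zero hr.hasDerivAt
    have hmin2 : IsLocalMin (fun τ => relu (z τ) - z τ) t :=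
      Eventually.of_forall fun τ => by simp [relu, h]
    have h1 := hmin2.hasDerivAt_eq_zero (hr.hasDerivAt.sub hz)
    have hz0 : z' = 0 := by linarith
    have := hr.hasDerivAt
    rw [h0] at this
    simpa [hz0] using this
  · rw [hpos h, one_mul]
    refine hz.congr_of_eventuallyEq ?_
    filter_upwards [hz.continuousAt.eventually (lt_mem_nhds h)] with τ hτ
    exact max_eq_left hτ.le

/-- The empirical Gram matrix `(1 / m) ∑ r, ξ i r * ξ j r * ⟪x i, x j⟫` of an activation
pattern `ξ`. -/
noncomputable def activationGram {n d m : ℕ} (x : Fin n → EuclideanSpace ℝ (Fin d))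
    (ξ : Fin n → Fin m → ℝ) (i j : Fin n) : ℝ :=
  (1 / (m : ℝ)) * ∑ r, ξ i r * ξ j r * inner ℝ (x i) (x j)

/-- The derivative of ReLU, with value `1` at `0`. -/
noncomputable def step (z : ℝ) : ℝ := (Ici (0 : ℝ)).indicator (fun _ => 1) z

theorem step_nonneg (z : ℝ) : 0 ≤ step z := indicator_nonneg (fun _ _ => zero_le_one) z

theorem step_le_one (z : ℝ) : step z ≤ 1 :=
  indicator_le' (fun _ _ => le_rfl) (fun _ _ => zero_le_one) z

/-- The indicator of the set of `z` with `|z| ≤ R`, on which a perturbation of size less than `R`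
may change the activation. -/
noncomputable def nearZero (R z : ℝ) : ℝ := (Icc (-R) R).indicator (fun _ => 1) z

theorem nearZero_nonneg (R z : ℝ) : 0 ≤ nearZero R z := indicator_nonneg (fun _ _ => zero_le_one) z

/-- If `|z₀| > R`, then `z` is nonzero with the sign of `z₀`; otherwise both numbers lie in `[0,
1]`. -/
theorem abs_sub_step_le {z z₀ s R : ℝ} (hs : s ∈ reluSubdifferential z) (h : |z - z₀| < R) :
    |s - step z₀| ≤ nearZero R z₀ := by
  obtain ⟨h0, h1, hpos, hneg⟩ := hs
  by_cases hz : z₀ ∈ Icc (-R) R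
  · have := step_nonneg z₀
    have := step_le_one z₀
    rw [nearZero, indicator_of_mem hz, abs_le]
    constructor <;> linarith
  · rw [nearZero, indicator_of_notMem hz]
    rw [abs_lt] at h
    rw [mem_Icc, not_and_or, not_le, not_le] at hz
    rcases hz with hz | hz
    · rw [hneg (by linarith), step, indicator_of_notMem (by simp; linarith)]; simp
    · rw [hpos (by linarith), step, indicator_of_mem (by simp; linarith)]; simp

theorem sum_abs_activationGram_sub_le {n d m : ℕ} {x : Fin n → EuclideanSpace ℝ (Fin d)}
    (hx : ∀ i, ‖x i‖ = 1) {ξ ξ₀ b : Fin n → Fin m → ℝ}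
    (hξ : ∀ i r, |ξ i r| ≤ 1) (hξ₀ : ∀ i r, |ξ₀ i r| ≤ 1) (hb : ∀ i r, |ξ i r - ξ₀ i r| ≤ b i r) :
    ∑ i, ∑ j, |activationGram x ξ i j - activationGram x ξ₀ i j| ≤
      (1 / (m : ℝ)) * (2 * n * ∑ i, ∑ r, b i r) := by
  have hentry : ∀ i j, |activationGram x ξ i j - activationGram x ξ₀ i j| ≤
      (1 / (m : ℝ)) * (∑ r, b i r + ∑ r, b j r) := by
    intro i j
    rw [activationGram, activationGram, ← mul_sub, ← Finset.sum_sub_distrib, abs_mul,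
      abs_of_nonneg (by positivity), ← Finset.sum_add_distrib]
    refine mul_le_mul_of_nonneg_left
      ((Finset.abs_sum_le_sum_abs _ _).trans (Finset.sum_le_sum fun r _ => ?_)) (by positivity)
    have hin : |(inner ℝ (x i) (x j) : ℝ)| ≤ 1 := by
      simpa [hx] using abs_real_inner_le_norm (x i) (x j)
    calc |ξ i r * ξ j r * inner ℝ (x i) (x j) - ξ₀ i r * ξ₀ j r * inner ℝ (x i) (x j)|
        -- The product is changed one factor at a time. Summing the resulting `b i r + b j r` over
        -- all pairs `(i, j)` gives the factor `2 * n`.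
        = |(ξ i r - ξ₀ i r) * ξ j r + ξ₀ i r * (ξ j r - ξ₀ j r)| * |inner ℝ (x i) (x j)| := by
          rw [← abs_mul]; ring_nf
      _ ≤ |(ξ i r - ξ₀ i r) * ξ j r + ξ₀ i r * (ξ j r - ξ₀ j r)| :=
          mul_le_of_le_one_right (abs_nonneg _) hin
      _ ≤ |ξ i r - ξ₀ i r| * |ξ j r| + |ξ₀ i r| * |ξ j r - ξ₀ j r| := by
          rw [← abs_mul, ← abs_mul]; exact abs_add_le _ _
      _ ≤ |ξ i r - ξ₀ i r| + |ξ j r - ξ₀ j r| :=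
          add_le_add (mul_le_of_le_one_right (abs_nonneg _) (hξ j r))
            (mul_le_of_le_one_left (abs_nonneg _) (hξ₀ i r))
      _ ≤ b i r + b j r := add_le_add (hb i r) (hb j r)
  refine (Finset.sum_le_sum fun i _ => Finset.sum_le_sum fun j _ => hentry i j).trans ?_
  simp only [← Finset.mul_sum, Finset.sum_add_distrib, Finset.sum_const, Finset.card_univ,
    Fintype.card_fin, nsmul_eq_mul]
  refine le_of_eq ?_
  ring

/-- A quadratic form is perturbed by at most the entrywise `ℓ¹` distance of the matrices. -/
theorem quadraticForm_sub_le {ι : Type*} [Fintype ι] (A B : ι → ι → ℝ) (v : ι → ℝ) :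
    ∑ i, ∑ j, v i * v j * A i j - ∑ i, ∑ j, v i * v j * B i j ≤
      (∑ i, ∑ j, |A i j - B i j|) * ∑ i, v i ^ 2 := by
  rw [← Finset.sum_sub_distrib, Finset.sum_mul]
  refine Finset.sum_le_sum fun i _ => ?_
  rw [← Finset.sum_sub_distrib, Finset.sum_mul]
  refine Finset.sum_le_sum fun j _ => ?_
  rw [← mul_sub, mul_comm |A i j - B i j|]
  have hi : v i ^ 2 ≤ ∑ k, v k ^ 2 :=
    Finset.single_le_sum (f := fun k => v k ^ 2) (fun k _ => sq_nonneg _) (Finset.mem_univ i)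
  have hj : v j ^ 2 ≤ ∑ k, v k ^ 2 :=
    Finset.single_le_sum (f := fun k => v k ^ 2) (fun k _ => sq_nonneg _) (Finset.mem_univ j)
  have hij : |v i * v j| ≤ ∑ k, v k ^ 2 := by
    rw [abs_le]
    constructor <;> nlinarith [sq_nonneg (v i + v j), sq_nonneg (v i - v j)]
  calc v i * v j * (A i j - B i j) ≤ |v i * v j| * |A i j - B i j| := by
        rw [← abs_mul]; exact le_abs_self _
    _ ≤ _ := mul_le_mul_of_nonneg_right hij (abs_nonneg _)

theorem hasDerivAt_network {n d m : ℕ} {x : Fin n → EuclideanSpace ℝ (Fin d)}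
    {y : EuclideanSpace ℝ (Fin n)} {a : Fin m → ℝ} (ha : ∀ r, a r ^ 2 = 1)
    {W : ℝ → Fin m → EuclideanSpace ℝ (Fin d)} {ξ : Fin n → Fin m → ℝ} {t : ℝ}
    (hξ : ∀ i r, ξ i r ∈ reluSubdifferential (inner ℝ (W t r) (x i)))
    (hW : ∀ r, HasDerivAt (fun s => W s r) (-gradientFormula x y a (W t) ξ r) t)
    (hd : ∀ i r, DifferentiableAt ℝ (fun s => relu (inner ℝ (W s r) (x i))) t) (i : Fin n) :
    HasDerivAt (fun s => network (W s) a (x i))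
      (-∑ j, activationGram x ξ i j * (network (W t) a (x j) - y j)) t := by
  have hz : ∀ r, HasDerivAt (fun s => (inner ℝ (W s r) (x i) : ℝ))
      (inner ℝ (-gradientFormula x y a (W t) ξ r) (x i)) t := fun r => by
    simpa using (hW r).inner ℝ (hasDerivAt_const t (x i))
  have h := (HasDerivAt.fun_sum (u := Finset.univ) fun r _ =>
    (hasDerivAt_relu_comp (hz r) (hd i r) (hξ i r)).const_mul (a r)).const_mul (1 / Real.sqrt m)
  refine (show HasDerivAt (fun s => network (W s) a (x i)) _ t from h).congr_deriv ?_
  have hm : 1 / (m : ℝ) = 1 / Real.sqrt m * (1 / Real.sqrt m) := by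
    rw [div_mul_div_comm, one_mul, Real.mul_self_sqrt (Nat.cast_nonneg m)]
  simp only [activationGram, gradientFormula, inner_neg_left, real_inner_smul_left, sum_inner, hm,
    Finset.mul_sum, Finset.sum_mul, mul_neg, Finset.sum_neg_distrib]
  rw [Finset.sum_comm]
  refine congrArg _ (Finset.sum_congr rfl fun j _ => Finset.sum_congr rfl fun r _ => ?_)
  rw [real_inner_comm (x i) (x j)]
  -- One `a r` comes from the network and one from the gradient; their product is `1`.
  linear_combination ((1 / Real.sqrt m * (1 / Real.sqrt m) * ξ i r * ξ j r * inner ℝ (x i) (x j)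
    * (network (W t) a (x j) - y j))) * ha r

end TwoLayerReLU

/-! ### Deterministic dynamics of the gradient flow. -/

namespace TwoLayerReLU

variable {n d m : ℕ} {x : Fin n → EuclideanSpace ℝ (Fin d)} {y : EuclideanSpace ℝ (Fin n)}
  {a : Fin m → ℝ} {W : ℝ → Fin m → EuclideanSpace ℝ (Fin d)} {R T lam : ℝ}

theorem lipschitzWith_inner_left {E : Type*} [NormedAddCommGroup E] [InnerProductSpace ℝ E]
    (v : E) : LipschitzWith ‖v‖₊ fun w : E => (inner ℝ w v : ℝ) := by
  refine LipschitzWith.of_dist_le_mul fun w w' => ?_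
  rw [Real.dist_eq, ← inner_sub_left, dist_eq_norm, coe_nnnorm, mul_comm]
  exact abs_real_inner_le_norm _ _

namespace IsGradientFlow

theorem absolutelyContinuous_relu (hW : IsGradientFlow x y a W) (hT : 0 ≤ T) (r : Fin m)
    (v : EuclideanSpace ℝ (Fin d)) :
    AbsolutelyContinuousOnInterval (fun t => relu (inner ℝ (W t r) v)) 0 T :=
  ((hW.absolutelyContinuous r T hT).lipschitzWith_comp
    (lipschitzWith_inner_left v)).lipschitzWith_comp lipschitzWith_relu

theorem absolutelyContinuous_network (hW : IsGradientFlow x y a W) (hT : 0 ≤ T)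
    (v : EuclideanSpace ℝ (Fin d)) :
    AbsolutelyContinuousOnInterval (fun t => network (W t) a v) 0 T :=
  (AbsolutelyContinuousOnInterval.fun_finsetSum _ fun r _ =>
    (hW.absolutelyContinuous_relu hT r v).const_mul (a r)).const_mul _

theorem ae_hasDerivAt (hW : IsGradientFlow x y a W) (ha : ∀ r, a r ^ 2 = 1) (hT : 0 ≤ T) :
    ∀ᵐ t, t ∈ Ioo 0 T → ∃ ξ : Fin n → Fin m → ℝ,
      (∀ i r, ξ i r ∈ reluSubdifferential (inner ℝ (W t r) (x i))) ∧
      (∀ r, HasDerivAt (fun s => W s r) (-gradientFormula x y a (W t) ξ r) t) ∧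
      ∀ i, HasDerivAt (fun s => network (W s) a (x i))
        (-∑ j, activationGram x ξ i j * (network (W t) a (x j) - y j)) t := by
  have h1 := (ae_restrict_iff' measurableSet_Ioi).1 hW.inclusion
  -- Absolute continuity gives differentiability of each ReLU term off a null set, which is what the
  -- chain rule needs at kinks; finitely many null sets are discarded.
  have h2 : ∀ᵐ t : ℝ, ∀ i r, t ∈ uIcc 0 T →
      DifferentiableAt ℝ (fun s => relu (inner ℝ (W s r) (x i))) t :=
    ae_all_iff.2 fun i => ae_all_iff.2 fun r =>
      (hW.absolutelyContinuous_relu hT r (x i)).ae_differentiableAt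
  filter_upwards [h1, h2] with t ht1 ht2 htm
  obtain ⟨G, ⟨ξ, hξ, rfl⟩, hG⟩ := ht1 htm.1
  have htI : t ∈ uIcc 0 T := by rw [uIcc_of_le hT]; exact Ioo_subset_Icc_self htm
  exact ⟨ξ, hξ, hG, hasDerivAt_network ha hξ hG fun i r => ht2 i r htI⟩

end IsGradientFlow

theorem reluSubdifferential_abs_le {z s : ℝ} (hs : s ∈ reluSubdifferential z) : |s| ≤ 1 :=
  abs_le.2 ⟨by linarith [hs.1], hs.2.1⟩

/-- The activation Gram matrix stays positive definite in a neighbourhood of the initialization. -/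
theorem quadraticForm_activationGram_ge (hx : ∀ i, ‖x i‖ = 1) (hm : 0 < m)
    {w₀ w : Fin m → EuclideanSpace ℝ (Fin d)}
    (hgram : ∀ v : Fin n → ℝ, 3 / 4 * lam * ∑ i, v i ^ 2 ≤
      ∑ i, ∑ j, v i * v j * activationGram x (fun i r => step (inner ℝ (w₀ r) (x i))) i j)
    (hcount : 2 * n * ∑ i, ∑ r, nearZero R (inner ℝ (w₀ r) (x i)) ≤ m * (lam / 4))
    (hw : ∀ r, ‖w r - w₀ r‖ < R) {ξ : Fin n → Fin m → ℝ}
    (hξ : ∀ i r, ξ i r ∈ reluSubdifferential (inner ℝ (w r) (x i))) (v : Fin n → ℝ) :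
    lam / 2 * ∑ i, v i ^ 2 ≤ ∑ i, ∑ j, v i * v j * activationGram x ξ i j := by
  set ξ₀ : Fin n → Fin m → ℝ := fun i r => step (inner ℝ (w₀ r) (x i)) with hξ₀
  have hξ₀1 : ∀ i r, |ξ₀ i r| ≤ 1 := fun i r =>
    abs_le.2 ⟨by linarith [step_nonneg (inner ℝ (w₀ r) (x i))], step_le_one _⟩
  have hb : ∀ i r, |ξ₀ i r - ξ i r| ≤ nearZero R (inner ℝ (w₀ r) (x i)) := fun i r => by
    rw [abs_sub_comm]
    refine abs_sub_step_le (hξ i r) ?_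
    rw [← inner_sub_left]
    refine (abs_real_inner_le_norm _ _).trans_lt ?_
    rw [hx, mul_one]
    exact hw r
  have h1 := quadraticForm_sub_le (activationGram x ξ₀) (activationGram x ξ) v
  have h2 := sum_abs_activationGram_sub_le hx hξ₀1
    (fun i r => reluSubdifferential_abs_le (hξ i r)) hb
  have hm' : (0 : ℝ) < m := by exact_mod_cast hm
  have h3 : (1 / (m : ℝ)) * (2 * n * ∑ i, ∑ r, nearZero R (inner ℝ (w₀ r) (x i))) ≤ lam / 4 := by
    rw [one_div_mul_eq_div, div_le_iff₀ hm']
    linarith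
  -- Of the initial bound `3/4 * lam`, the changed activations cost at most `lam / 4`.
  have h4 := mul_le_mul_of_nonneg_right (h2.trans h3)
    (Finset.sum_nonneg fun i (_ : i ∈ Finset.univ) => sq_nonneg (v i))
  have h5 := hgram v
  linarith

theorem norm_prediction_sub_sq (a : Fin m → ℝ) (w : Fin m → EuclideanSpace ℝ (Fin d)) :
    ‖prediction x a w - y‖ ^ 2 = ∑ i, (network w a (x i) - y i) ^ 2 := by
  simp [EuclideanSpace.norm_sq_eq, prediction]

/-- Cauchy–Schwarz turns the `ℓ¹` norm of the residual into `√n` times its `ℓ²` norm. The factor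
`1/√m` is what keeps each neuron slow in a wide network. -/
theorem norm_gradientFormula_le (hx : ∀ i, ‖x i‖ = 1) (ha : ∀ r, a r ^ 2 = 1)
    {w : Fin m → EuclideanSpace ℝ (Fin d)} {ξ : Fin n → Fin m → ℝ}
    (hξ : ∀ i r, |ξ i r| ≤ 1) (r : Fin m) :
    ‖gradientFormula x y a w ξ r‖ ≤ Real.sqrt (n / m) * ‖prediction x a w - y‖ := by
  have ha1 : |a r| = 1 := by rw [← sq_eq_sq₀ (abs_nonneg _) zero_le_one, sq_abs, ha, one_pow]
  have h1 : ∑ i, |network w a (x i) - y i| ≤ Real.sqrt n * ‖prediction x a w - y‖ := by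
    refine Real.le_sqrt_of_sq_le ?_ |>.trans_eq ?_ (b := Real.sqrt (n * ‖prediction x a w - y‖ ^ 2))
    · rw [norm_prediction_sub_sq]
      simpa using sq_sum_le_card_mul_sum_sq (s := Finset.univ)
        (f := fun i => |network w a (x i) - y i|)
    · rw [Real.sqrt_mul (Nat.cast_nonneg n), Real.sqrt_sq (norm_nonneg _)]
  calc ‖gradientFormula x y a w ξ r‖
      ≤ 1 / Real.sqrt m * ∑ i, |network w a (x i) - y i| := by
        rw [gradientFormula, norm_smul, Real.norm_of_nonneg (by positivity)]
        refine mul_le_mul_of_nonneg_left ((norm_sum_le _ _).trans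
          (Finset.sum_le_sum fun i _ => ?_)) (by positivity)
        rw [norm_smul, hx, mul_one, Real.norm_eq_abs, abs_mul, abs_mul, ha1, mul_one]
        exact mul_le_of_le_one_right (abs_nonneg _) (hξ i r)
    _ ≤ 1 / Real.sqrt m * (Real.sqrt n * ‖prediction x a w - y‖) :=
        mul_le_mul_of_nonneg_left h1 (by positivity)
    _ = Real.sqrt (n / m) * ‖prediction x a w - y‖ := by
        rw [Real.sqrt_div (Nat.cast_nonneg n)]; ring

theorem absolutelyContinuous_exp_mul (c T : ℝ) :
    AbsolutelyContinuousOnInterval (fun t => Real.exp (c * t)) 0 T :=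
  ContDiffOn.absolutelyContinuousOnInterval (by fun_prop)

theorem hasDerivAt_exp_mul (c t : ℝ) :
    HasDerivAt (fun s => Real.exp (c * s)) (Real.exp (c * t) * c) t := by
  simpa using ((hasDerivAt_id t).const_mul c).exp

/-- While the activation Gram matrix stays positive definite, the loss decays exponentially. -/
theorem IsGradientFlow.norm_prediction_sub_sq_le (hW : IsGradientFlow x y a W)
    (ha : ∀ r, a r ^ 2 = 1) (hT : 0 ≤ T)
    (hquad : ∀ t ∈ Ioo 0 T, ∀ ξ : Fin n → Fin m → ℝ,
      (∀ i r, ξ i r ∈ reluSubdifferential (inner ℝ (W t r) (x i))) → ∀ v : Fin n → ℝ,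
      lam / 2 * ∑ i, v i ^ 2 ≤ ∑ i, ∑ j, v i * v j * activationGram x ξ i j) :
    ‖prediction x a (W T) - y‖ ^ 2 ≤ Real.exp (-lam * T) * ‖prediction x a (W 0) - y‖ ^ 2 := by
  simp only [norm_prediction_sub_sq]
  have hu : ∀ i, AbsolutelyContinuousOnInterval (fun t => network (W t) a (x i) - y i) 0 T :=
    fun i => (hW.absolutelyContinuous_network hT (x i)).fun_sub
      (LipschitzWith.const (y i)).lipschitzOnWith.absolutelyContinuousOnInterval
  -- The integrating factor turns `(‖e‖²)' ≤ -lam * ‖e‖²` into monotonicity.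
  have hac : AbsolutelyContinuousOnInterval (fun t => Real.exp (lam * t) *
      ∑ i, (network (W t) a (x i) - y i) * (network (W t) a (x i) - y i)) 0 T :=
    (absolutelyContinuous_exp_mul lam T).fun_mul
      (AbsolutelyContinuousOnInterval.fun_finsetSum _ fun i _ => (hu i).fun_mul (hu i))
  have hmono := hac.le_of_ae_hasDerivAt_nonpos hT (by
    filter_upwards [hW.ae_hasDerivAt ha hT] with t ht htm
    obtain ⟨ξ, hξ, -, hnet⟩ := ht htm
    have hv : ∀ i, HasDerivAt (fun s => network (W s) a (x i) - y i)
        (-∑ j, activationGram x ξ i j * (network (W t) a (x j) - y j)) t :=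
      fun i => (hnet i).sub_const _
    have hq := hquad t htm ξ hξ fun i => network (W t) a (x i) - y i
    refine ⟨_, (hasDerivAt_exp_mul lam t).mul
      (HasDerivAt.fun_sum fun i _ => (hv i).mul (hv i)), ?_⟩
    have hsum : ∑ i, (-(∑ j, activationGram x ξ i j * (network (W t) a (x j) - y j)) *
        (network (W t) a (x i) - y i) + (network (W t) a (x i) - y i) *
        -(∑ j, activationGram x ξ i j * (network (W t) a (x j) - y j))) =
        -2 * ∑ i, ∑ j, (network (W t) a (x i) - y i) * (network (W t) a (x j) - y j) *
          activationGram x ξ i j := by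
      rw [Finset.mul_sum]
      refine Finset.sum_congr rfl fun i _ => ?_
      rw [show ∀ p q : ℝ, -p * q + q * -p = -2 * (q * p) by intros; ring, Finset.mul_sum]
      congr 1
      exact Finset.sum_congr rfl fun j _ => by ring
    rw [hsum]
    simp only [← sq] at hq ⊢
    nlinarith [Real.exp_pos (lam * t)])
  simp only [mul_zero, Real.exp_zero, one_mul, ← sq] at hmono
  rw [neg_mul, Real.exp_neg, ← div_eq_inv_mul, le_div_iff₀ (Real.exp_pos _)]
  linarith

/-- If the loss decays exponentially, the weights move by a bounded amount. -/
theorem IsGradientFlow.norm_sub_le (hW : IsGradientFlow x y a W) (hx : ∀ i, ‖x i‖ = 1)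
    (ha : ∀ r, a r ^ 2 = 1) (hlam : 0 < lam) (hT : 0 ≤ T)
    (hdecay : ∀ t ∈ Ioo 0 T, ‖prediction x a (W t) - y‖ ^ 2 ≤
      Real.exp (-lam * t) * ‖prediction x a (W 0) - y‖ ^ 2) (r : Fin m) :
    ‖W T r - W 0 r‖ ≤ Real.sqrt (n / m) * ‖prediction x a (W 0) - y‖ * (2 / lam) := by
  set c := Real.sqrt (n / m) * ‖prediction x a (W 0) - y‖ with hc
  have hc0 : 0 ≤ c := by positivity
  -- Pairing with the fixed final displacement makes the problem scalar. The derivative of the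
  -- exponential term added below cancels the speed bound, so the sum is nonincreasing.
  set e := W T r - W 0 r with he
  have hac : AbsolutelyContinuousOnInterval
      (fun t => (inner ℝ (W t r) e : ℝ) + ‖e‖ * c * (2 / lam) * Real.exp (-lam / 2 * t)) 0 T :=
    ((hW.absolutelyContinuous r T hT).lipschitzWith_comp (lipschitzWith_inner_left e)).fun_add
      ((absolutelyContinuous_exp_mul _ T).const_mul _)
  have hmono := hac.le_of_ae_hasDerivAt_nonpos hT (by
    filter_upwards [hW.ae_hasDerivAt ha hT] with t ht htm
    obtain ⟨ξ, hξ, hG, -⟩ := ht htm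
    have hz : HasDerivAt (fun s => (inner ℝ (W s r) e : ℝ))
        (inner ℝ (-gradientFormula x y a (W t) ξ r) e) t := by
      simpa using (hG r).inner ℝ (hasDerivAt_const t e)
    refine ⟨_, hz.add ((hasDerivAt_exp_mul (-lam / 2) t).const_mul _), ?_⟩
    have h1 := norm_gradientFormula_le (y := y) (w := W t) hx ha
      (fun i r => reluSubdifferential_abs_le (hξ i r)) r
    have h2 : ‖prediction x a (W t) - y‖ ≤
        Real.exp (-lam / 2 * t) * ‖prediction x a (W 0) - y‖ := by
      refine le_of_sq_le_sq ?_ (by positivity)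
      rw [mul_pow, ← Real.exp_nat_mul]
      rw [show ((2 : ℕ) : ℝ) * (-lam / 2 * t) = -lam * t by push_cast; ring]
      exact hdecay t htm
    have h3 : (inner ℝ (-gradientFormula x y a (W t) ξ r) e : ℝ) ≤
        c * Real.exp (-lam / 2 * t) * ‖e‖ := by
      refine (real_inner_le_norm _ _).trans (mul_le_mul_of_nonneg_right ?_ (norm_nonneg _))
      rw [norm_neg]
      refine h1.trans ((mul_le_mul_of_nonneg_left h2 (Real.sqrt_nonneg _)).trans_eq ?_)
      rw [hc]; ring
    have h4 : ‖e‖ * c * (2 / lam) * (Real.exp (-lam / 2 * t) * (-lam / 2)) =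
        -(c * Real.exp (-lam / 2 * t) * ‖e‖) := by
      field_simp
    linarith)
  simp only [mul_zero, Real.exp_zero, mul_one] at hmono
  have h5 : ‖e‖ * ‖e‖ ≤ ‖e‖ * (c * (2 / lam)) := by
    have h6 : (inner ℝ (W T r) e : ℝ) - inner ℝ (W 0 r) e = ‖e‖ * ‖e‖ := by
      rw [← inner_sub_left, ← he, real_inner_self_eq_norm_mul_norm]
    have h7 : 0 ≤ ‖e‖ * c * (2 / lam) * Real.exp (-lam / 2 * T) := by positivity
    linarith
  rcases (norm_nonneg e).eq_or_lt with h | h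
  · rw [← h]; positivity
  · exact le_of_mul_le_mul_left h5 h

/-- Deterministic convergence: the loss decays exponentially if the initial Gram matrix is positive
definite, few neurons are near an activation boundary, and the initial loss is small compared with
the width. -/
theorem IsGradientFlow.norm_prediction_sub_sq_le_of_init (hW : IsGradientFlow x y a W)
    (hx : ∀ i, ‖x i‖ = 1) (ha : ∀ r, a r ^ 2 = 1) (hm : 0 < m) (hlam : 0 < lam)
    (hgram : ∀ v : Fin n → ℝ, 3 / 4 * lam * ∑ i, v i ^ 2 ≤
      ∑ i, ∑ j, v i * v j * activationGram x (fun i r => step (inner ℝ (W 0 r) (x i))) i j)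
    (hcount : 2 * n * ∑ i, ∑ r, nearZero R (inner ℝ (W 0 r) (x i)) ≤ m * (lam / 4))
    (hR : Real.sqrt (n / m) * ‖prediction x a (W 0) - y‖ * (2 / lam) < R) (hT : 0 ≤ T) :
    ‖prediction x a (W T) - y‖ ^ 2 ≤ Real.exp (-lam * T) * ‖prediction x a (W 0) - y‖ ^ 2 := by
  have hdecay : ∀ S, 0 ≤ S → (∀ t ∈ Ioo 0 S, ∀ r, ‖W t r - W 0 r‖ < R) →
      ‖prediction x a (W S) - y‖ ^ 2 ≤
        Real.exp (-lam * S) * ‖prediction x a (W 0) - y‖ ^ 2 := fun S hS h =>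
    hW.norm_prediction_sub_sq_le ha hS fun t ht ξ hξ v =>
      quadraticForm_activationGram_ge hx hm hgram hcount (h t ht) hξ v
  -- Closeness before `S` gives decay before `S`, hence the displacement bound at `S`. As `hR` is
  -- strict, `S` cannot be an exit time.
  have hclose : ∀ S, 0 ≤ S → (∀ t ∈ Ioo 0 S, ∀ r, ‖W t r - W 0 r‖ < R) →
      ∀ r, ‖W S r - W 0 r‖ < R := fun S hS h r =>
    (hW.norm_sub_le hx ha hlam hS (fun t ht => hdecay t ht.1.le fun s hs =>
      h s ⟨hs.1, hs.2.trans ht.2⟩) r).trans_lt hR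
  refine hdecay T hT fun t ht => ?_
  by_contra! hfar
  obtain ⟨r, hr⟩ := hfar
  -- the first time at which some weight leaves the ball
  set S : Set ℝ := ⋃ r, {s ∈ Icc 0 T | R ≤ ‖W s r - W 0 r‖} with hS
  have hSclosed : IsClosed S := by
    refine isClosed_iUnion_of_finite fun r => ?_
    have hcont := (hW.absolutelyContinuous r T hT).continuousOn
    rw [uIcc_of_le hT] at hcont
    exact isClosed_Icc.isClosed_le continuousOn_const (hcont.sub continuousOn_const).norm
  have hSne : S.Nonempty := ⟨t, mem_iUnion.2 ⟨r, Ioo_subset_Icc_self ht, hr⟩⟩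
  have hSbdd : BddBelow S := ⟨0, fun s hs => by
    obtain ⟨_, hs, _⟩ := mem_iUnion.1 hs; exact hs.1⟩
  obtain ⟨r₀, h0, h1⟩ := mem_iUnion.1 (hSclosed.csInf_mem hSne hSbdd)
  refine (hclose _ h0.1 (fun s hs r' => ?_) r₀).not_ge h1
  by_contra! h
  exact (notMem_of_lt_csInf hs.2 hSbdd)
    (mem_iUnion.2 ⟨r', ⟨hs.1.le, hs.2.le.trans h0.2⟩, h⟩)

end TwoLayerReLU

/-! ### Least eigenvalues, Gaussian estimates, sample means and random signs. -/

namespace TwoLayerReLU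

section LeastEigenvalue

variable {n : ℕ} {A : Matrix (Fin n) (Fin n) ℝ}

/-- Subtracting `leastEigenvalue A` times the identity shifts the spectrum to nonnegative numbers,
so the difference is positive semidefinite. -/
theorem leastEigenvalue_mul_le (hA : A.IsHermitian) (v : Fin n → ℝ) :
    leastEigenvalue A * ∑ i, v i ^ 2 ≤ ∑ i, ∑ j, v i * v j * A i j := by
  have hB : (A - algebraMap ℝ _ (leastEigenvalue A)).IsHermitian :=
    hA.sub (by simp [Matrix.algebraMap_eq_diagonal])
  have hpos : (A - algebraMap ℝ _ (leastEigenvalue A)).PosSemidef := by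
    refine hB.posSemidef_iff_eigenvalues_nonneg.2 fun i => ?_
    have hmem := hB.eigenvalues_mem_spectrum_real i
    rw [← spectrum.sub_singleton_eq] at hmem
    obtain ⟨z, hz, w, rfl, hzw⟩ := Set.mem_sub.1 hmem
    rw [← hzw]
    refine sub_nonneg.2 (csInf_le ?_ hz)
    rw [hA.spectrum_real_eq_range_eigenvalues]
    exact (Set.finite_range _).bddBelow
  have h := hpos.dotProduct_mulVec_nonneg v
  rw [Matrix.sub_mulVec, dotProduct_sub, Matrix.algebraMap_eq_diagonal] at h
  have h1 : star v ⬝ᵥ A.mulVec v = ∑ i, ∑ j, v i * v j * A i j := by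
    simp only [dotProduct, Matrix.mulVec, Finset.mul_sum, star_trivial]
    exact Finset.sum_congr rfl fun i _ => Finset.sum_congr rfl fun j _ => by ring
  have h2 : star v ⬝ᵥ (Matrix.diagonal (algebraMap ℝ (Fin n → ℝ) (leastEigenvalue A))).mulVec v =
      leastEigenvalue A * ∑ i, v i ^ 2 := by
    simp only [dotProduct, Matrix.mulVec_diagonal, Finset.mul_sum, star_trivial, Pi.algebraMap_apply,
      Algebra.algebraMap_self, RingHom.id_apply]
    exact Finset.sum_congr rfl fun i _ => by ring
  linarith

theorem leastEigenvalue_le_diag (hA : A.IsHermitian) (i : Fin n) : leastEigenvalue A ≤ A i i := by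
  have h := leastEigenvalue_mul_le hA (Pi.single i 1)
  simpa [Pi.single_apply, ite_pow] using h

theorem pos_of_leastEigenvalue_pos (h : 0 < leastEigenvalue A) : 0 < n := by
  rcases Nat.eq_zero_or_pos n with rfl | hn
  -- The spectrum of the empty matrix is empty, and `sInf ∅ = 0`.
  · simp [leastEigenvalue, spectrum.of_subsingleton] at h
  · exact hn

end LeastEigenvalue

section Gaussian

variable {E : Type*} [NormedAddCommGroup E] [InnerProductSpace ℝ E] [FiniteDimensional ℝ E]
  [MeasurableSpace E] [BorelSpace E]

theorem map_inner_stdGaussian {v : E} (hv : ‖v‖ = 1) :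
    (stdGaussian E).map (fun w => (inner ℝ w v : ℝ)) = gaussianReal 0 1 := by
  have h := IsGaussian.map_eq_gaussianReal (μ := stdGaussian E) (innerSL ℝ v)
  rw [integral_strongDual_stdGaussian, variance_dual_stdGaussian, innerSL_apply_norm, hv] at h
  convert h using 2
  · ext w; exact real_inner_comm _ _
  · simp

theorem memLp_inner_stdGaussian (v : E) :
    MemLp (fun w => (inner ℝ w v : ℝ)) 2 (stdGaussian E) := by
  convert IsGaussian.memLp_dual (stdGaussian E) (innerSL ℝ v) 2 (by simp) using 1
  ext w; exact real_inner_comm _ _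

theorem integral_inner_sq_stdGaussian {v : E} (hv : ‖v‖ = 1) :
    ∫ w, (inner ℝ w v : ℝ) ^ 2 ∂(stdGaussian E) = 1 := by
  have h1 : ∫ z, z ^ 2 ∂(gaussianReal 0 1) = 1 := by
    have := variance_of_integral_eq_zero (X := id) (μ := gaussianReal 0 1) aemeasurable_id
      (by simp)
    rw [variance_id_gaussianReal] at this
    simpa using this.symm
  rw [← map_inner_stdGaussian hv, integral_map (by fun_prop) (by fun_prop)] at h1
  exact h1

/-- The density is at most `1/√(2π) ≤ 1/2` and the interval has length `2R`. -/
theorem gaussianReal_real_Icc_le {R : ℝ} (hR : 0 ≤ R) :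
    (gaussianReal 0 1).real (Icc (-R) R) ≤ R := by
  rw [measureReal_def, gaussianReal_apply_eq_integral 0 one_ne_zero,
    ENNReal.toReal_ofReal (integral_nonneg fun _ => gaussianPDFReal_nonneg _ _ _)]
  have hpdf : ∀ z, gaussianPDFReal 0 1 z ≤ 1 / 2 := fun z => by
    rw [gaussianPDFReal_def]
    have h2 : 2 ≤ √(2 * Real.pi * ((1 : NNReal) : ℝ)) := by
      refine Real.le_sqrt_of_sq_le ?_
      have := Real.pi_gt_three
      push_cast
      linarith
    refine (mul_le_mul (inv_anti₀ two_pos h2) (Real.exp_le_one_iff.2 ?_)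
      (Real.exp_pos _).le (by norm_num)).trans (by norm_num)
    · exact div_nonpos_of_nonpos_of_nonneg (by nlinarith [sq_nonneg (z - 0)]) (by positivity)
  calc ∫ z in Icc (-R) R, gaussianPDFReal 0 1 z
      ≤ ∫ z in Icc (-R) R, (1 / 2 : ℝ) :=
        setIntegral_mono (integrable_gaussianPDFReal 0 1).integrableOn (by simp) hpdf
    _ = R := by
        simp [measureReal_def, ENNReal.toReal_ofReal (by linarith : 0 ≤ R + R)]; ring

theorem integral_nearZero_inner_le {v : E} (hv : ‖v‖ = 1) {R : ℝ} (hR : 0 ≤ R) :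
    ∫ w, nearZero R (inner ℝ w v) ∂(stdGaussian E) ≤ R := by
  have hm : Measurable (nearZero R) := measurable_const.indicator measurableSet_Icc
  rw [← integral_map (φ := fun w : E => (inner ℝ w v : ℝ)) (f := nearZero R) (by fun_prop)
    hm.aestronglyMeasurable, map_inner_stdGaussian hv]
  refine le_of_eq_of_le ?_ (gaussianReal_real_Icc_le hR)
  exact integral_indicator_one measurableSet_Icc

end Gaussian

section Sampling

variable {Ω : Type*} [MeasurableSpace Ω] {μ : Measure Ω} [IsProbabilityMeasure μ] {m : ℕ}

theorem integral_comp_eval_const {g : Ω → ℝ} (hg : AEStronglyMeasurable g μ) (r : Fin m) :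
    ∫ w, g (w r) ∂(Measure.pi fun _ : Fin m => μ) = ∫ z, g z ∂μ := by
  have h := (measurePreserving_eval (fun _ : Fin m => μ) r).map_eq
  conv_rhs => rw [← h]
  rw [integral_map (measurable_pi_apply r).aemeasurable (by rwa [h])]

theorem integrable_comp_eval_const {g : Ω → ℝ} (hg : Integrable g μ) (r : Fin m) :
    Integrable (fun w : Fin m → Ω => g (w r)) (Measure.pi fun _ => μ) :=
  (measurePreserving_eval (fun _ : Fin m => μ) r).integrable_comp_of_integrable hg

/-- The mean squared error of the empirical mean of `m` independent samples of a function bounded by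
`1` is at most `1 / m`. -/
theorem integral_sampleMean_sub_sq_le (hm : 0 < m) {g : Ω → ℝ} (hg : Measurable g)
    (hg1 : ∀ z, |g z| ≤ 1) :
    ∫ w, ((1 / (m : ℝ)) * ∑ r, g (w r) - ∫ z, g z ∂μ) ^ 2 ∂(Measure.pi fun _ : Fin m => μ) ≤
      1 / (m : ℝ) := by
  have hm' : (m : ℝ) ≠ 0 := by exact_mod_cast hm.ne'
  have hLp : MemLp g 2 μ := MemLp.of_bound hg.aestronglyMeasurable 1 (ae_of_all _ hg1)
  have hvar := variance_sum_pi (μ := fun _ : Fin m => μ) (X := fun _ z => (1 / (m : ℝ)) * g z)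
    fun _ => hLp.const_mul _
  have hX : (∑ r, fun w : Fin m → Ω => (1 / (m : ℝ)) * g (w r)) =
      fun w => (1 / (m : ℝ)) * ∑ r, g (w r) := by
    ext w; simp [Finset.mul_sum]
  have hmean : ∫ w, (1 / (m : ℝ)) * ∑ r, g (w r) ∂(Measure.pi fun _ : Fin m => μ) =
      ∫ z, g z ∂μ := by
    rw [integral_const_mul, integral_finsetSum _ fun r _ =>
      integrable_comp_eval_const (hLp.integrable (by norm_num)) r]
    simp only [integral_comp_eval_const hg.aestronglyMeasurable, Finset.sum_const, Finset.card_univ,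
      Fintype.card_fin, nsmul_eq_mul]
    field_simp
  have hmeas : Measurable fun w : Fin m → Ω => (1 / (m : ℝ)) * ∑ r, g (w r) :=
    (Finset.measurable_sum _ fun r _ => hg.comp (measurable_pi_apply r)).const_mul _
  rw [hX, variance_eq_integral hmeas.aemeasurable, hmean] at hvar
  rw [hvar]
  simp only [variance_const_mul, Finset.sum_const, Finset.card_univ, Fintype.card_fin, nsmul_eq_mul]
  have hv1 : Var[g; μ] ≤ 1 := by
    refine (variance_le_expectation_sq hg.aestronglyMeasurable).trans ?_
    refine (integral_mono_of_nonneg (ae_of_all _ fun z => sq_nonneg (g z))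
      (integrable_const (1 : ℝ)) (ae_of_all _ fun z => ?_)).trans_eq (by simp)
    exact (sq_le_one_iff_abs_le_one (g z)).2 (hg1 z)
  calc (m : ℝ) * ((1 / (m : ℝ)) ^ 2 * Var[g; μ]) ≤ (m : ℝ) * ((1 / (m : ℝ)) ^ 2 * 1) := by gcongr
    _ = 1 / (m : ℝ) := by field_simp

/-- Markov's inequality, arranged so that `η` is the allotted failure probability. -/
theorem measure_ge_le_of_integral_le {f : Ω → ℝ} (hf0 : ∀ z, 0 ≤ f z) (hf : Integrable f μ) {ε η : ℝ}
    (hε : 0 < ε) (h : ∫ z, f z ∂μ ≤ ε * η) : μ {z | ε ≤ f z} ≤ ENNReal.ofReal η := by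
  have h1 := (mul_meas_ge_le_integral_of_nonneg (ae_of_all _ hf0) hf ε).trans h
  have h2 := le_of_mul_le_mul_left h1 hε
  rw [measureReal_def] at h2
  exact ENNReal.le_ofReal_iff_toReal_le (measure_ne_top _ _) (ENNReal.toReal_nonneg.trans h2) |>.2 h2

end Sampling

section Signs

/-- The uniform law on `{-1, 1}`. -/
noncomputable abbrev signLaw : Measure ℝ := uniformOn ({-1, 1} : Set ℝ)

instance isProbabilityMeasure_signLaw : IsProbabilityMeasure signLaw :=
  isProbabilityMeasure_uniformOn (by simp) (by simp)

theorem ae_signLaw_sq : ∀ᵐ s ∂signLaw, s ^ 2 = 1 := by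
  have h : ∀ᵐ s ∂signLaw, s ∈ ({-1, 1} : Set ℝ) := ae_cond_mem (by measurability)
  filter_upwards [h] with s hs
  rcases hs with rfl | rfl <;> norm_num

theorem memLp_id_signLaw : MemLp (id : ℝ → ℝ) 2 signLaw := by
  refine MemLp.of_bound aestronglyMeasurable_id 1 ?_
  filter_upwards [ae_signLaw_sq] with s hs
  exact (sq_le_one_iff_abs_le_one s).1 hs.le

theorem integral_id_signLaw : ∫ s, s ∂signLaw = 0 := by
  rw [signLaw, uniformOn, ProbabilityTheory.cond, integral_smul_measure, insert_eq,
    Measure.restrict_union (by norm_num) (measurableSet_singleton _), Measure.restrict_singleton,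
    Measure.restrict_singleton, Measure.count_singleton, Measure.count_singleton, one_smul, one_smul,
    integral_add_measure (integrable_dirac (by simp)) (integrable_dirac (by simp))]
  simp

theorem integral_mul_signLaw {m : ℕ} (r s : Fin m) :
    ∫ a, a r * a s ∂(Measure.pi fun _ : Fin m => signLaw) = if r = s then 1 else 0 := by
  split_ifs with h
  · subst h
    rw [integral_comp_eval_const (g := fun z => z * z) (by fun_prop)]
    rw [integral_congr_ae (g := fun _ => (1 : ℝ)) (by
      filter_upwards [ae_signLaw_sq] with s hs
      rw [← sq, hs])]
    simp
  · have hind := (iIndepFun_pi (μ := fun _ : Fin m => signLaw) (X := fun _ z => z)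
      fun _ => aemeasurable_id).indepFun h
    rw [hind.integral_fun_mul_eq_mul_integral
      (measurable_pi_apply r).aestronglyMeasurable (measurable_pi_apply s).aestronglyMeasurable]
    rw [integral_comp_eval_const (g := fun z => z) (by fun_prop), integral_id_signLaw, zero_mul]

end Signs

end TwoLayerReLU

/-! ### Moments under the random initialization. -/

namespace TwoLayerReLU

variable {n d m : ℕ} {x : Fin n → EuclideanSpace ℝ (Fin d)}

instance isProbabilityMeasure_initLaw : IsProbabilityMeasure (initLaw d m) := by
  have : IsProbabilityMeasure (uniformOn ({-1, 1} : Set ℝ)) := isProbabilityMeasure_signLaw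
  unfold initLaw
  infer_instance

theorem initLaw_eq : initLaw d m =
    (Measure.pi fun _ : Fin m => stdGaussian (EuclideanSpace ℝ (Fin d))).prod
      (Measure.pi fun _ : Fin m => signLaw) := rfl

theorem ae_initLaw_sq : ∀ᵐ p ∂(initLaw d m), ∀ r, p.2 r ^ 2 = 1 := by
  rw [initLaw_eq]
  refine Measure.quasiMeasurePreserving_snd.ae (p := fun a : Fin m → ℝ => ∀ r, a r ^ 2 = 1) ?_
  exact ae_all_iff.2 fun r =>
    (measurePreserving_eval (fun _ : Fin m => signLaw) r).quasiMeasurePreserving.ae ae_signLaw_sq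

theorem integral_initLaw_fst
    (f : (Fin m → EuclideanSpace ℝ (Fin d)) → ℝ) :
    ∫ p, f p.1 ∂(initLaw d m) =
      ∫ w, f w ∂(Measure.pi fun _ : Fin m => stdGaussian (EuclideanSpace ℝ (Fin d))) := by
  rw [initLaw_eq, integral_fun_fst]
  simp

theorem integrable_initLaw_fst {f : (Fin m → EuclideanSpace ℝ (Fin d)) → ℝ}
    (hf : Integrable f (Measure.pi fun _ => stdGaussian (EuclideanSpace ℝ (Fin d)))) :
    Integrable (fun p => f p.1) (initLaw d m) := by
  rw [initLaw_eq]
  exact hf.comp_fst _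

section Network

theorem network_sq (w : Fin m → EuclideanSpace ℝ (Fin d)) (a : Fin m → ℝ)
    (v : EuclideanSpace ℝ (Fin d)) :
    network w a v ^ 2 = (1 / (m : ℝ)) * ∑ r, ∑ s,
      (relu (inner ℝ (w r) v) * relu (inner ℝ (w s) v)) * (a r * a s) := by
  rw [network, mul_pow, div_pow, Real.sq_sqrt (Nat.cast_nonneg m), one_pow, sq (∑ r, _),
    Finset.sum_mul_sum]
  congr 1
  exact Finset.sum_congr rfl fun r _ => Finset.sum_congr rfl fun s _ => by ring

theorem memLp_relu_inner (v : EuclideanSpace ℝ (Fin d)) :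
    MemLp (fun w => relu (inner ℝ w v)) 2 (stdGaussian (EuclideanSpace ℝ (Fin d))) := by
  refine (memLp_inner_stdGaussian v).mono ?_ (ae_of_all _ fun w => ?_)
  · exact (lipschitzWith_relu.continuous.comp
      (lipschitzWith_inner_left v).continuous).aestronglyMeasurable
  · simpa [relu] using abs_max_sub_max_le_abs (inner ℝ w v) 0 0

theorem integrable_network_term (v : EuclideanSpace ℝ (Fin d)) (r s : Fin m) :
    Integrable (fun p : (Fin m → EuclideanSpace ℝ (Fin d)) × (Fin m → ℝ) =>
      (relu (inner ℝ (p.1 r) v) * relu (inner ℝ (p.1 s) v)) * (p.2 r * p.2 s)) (initLaw d m) := by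
  have h1 : ∀ r : Fin m, MemLp (fun w : Fin m → EuclideanSpace ℝ (Fin d) => relu (inner ℝ (w r) v))
      2 (Measure.pi fun _ => stdGaussian (EuclideanSpace ℝ (Fin d))) := fun r =>
    (memLp_relu_inner v).comp_measurePreserving (measurePreserving_eval _ r)
  have h2 : ∀ r : Fin m, MemLp (fun a : Fin m → ℝ => a r) 2 (Measure.pi fun _ => signLaw) :=
    fun r => memLp_id_signLaw.comp_measurePreserving (measurePreserving_eval _ r)
  rw [initLaw_eq]
  exact ((h1 r).integrable_mul (h1 s)).mul_prod ((h2 r).integrable_mul (h2 s))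

theorem integrable_network_sq (v : EuclideanSpace ℝ (Fin d)) :
    Integrable (fun p => network p.1 p.2 v ^ 2) (initLaw d m) := by
  simp only [network_sq]
  exact (integrable_finsetSum _ fun r _ => integrable_finsetSum _ fun s _ =>
    integrable_network_term v r s).const_mul _

/-- Independent centred signs kill the cross terms. Each of the `m` diagonal terms is at most `𝔼 ⟪w,
v⟫² = 1`, and the prefactor `1/m` averages them. -/
theorem integral_network_sq_le (hm : 0 < m) {v : EuclideanSpace ℝ (Fin d)} (hv : ‖v‖ = 1) :
    ∫ p, network p.1 p.2 v ^ 2 ∂(initLaw d m) ≤ 1 := by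
  have hm' : (m : ℝ) ≠ 0 := by exact_mod_cast hm.ne'
  have hrelu : ∫ w, relu (inner ℝ w v) * relu (inner ℝ w v)
      ∂(stdGaussian (EuclideanSpace ℝ (Fin d))) ≤ 1 := by
    rw [← integral_inner_sq_stdGaussian hv]
    refine integral_mono_of_nonneg (ae_of_all _ fun w => mul_self_nonneg _)
      (memLp_inner_stdGaussian v).integrable_sq (ae_of_all _ fun w => ?_)
    simp only [relu]
    rcases max_cases (inner ℝ w v : ℝ) 0 with h | h <;> rw [h.1] <;> nlinarith
  have hterm : ∀ r s : Fin m, ∫ p, (relu (inner ℝ (p.1 r) v) * relu (inner ℝ (p.1 s) v)) *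
      (p.2 r * p.2 s) ∂(initLaw d m) ≤ if r = s then 1 else 0 := fun r s => by
    rw [initLaw_eq, integral_prod_mul (fun w : Fin m → EuclideanSpace ℝ (Fin d) =>
      relu (inner ℝ (w r) v) * relu (inner ℝ (w s) v)) (fun a : Fin m → ℝ => a r * a s),
      integral_mul_signLaw]
    split_ifs with h
    · subst h
      rw [mul_one, integral_comp_eval_const (g := fun w => relu (inner ℝ w v) * relu (inner ℝ w v))
        ((memLp_relu_inner v).aestronglyMeasurable.mul (memLp_relu_inner v).aestronglyMeasurable)]
      exact hrelu
    · rw [mul_zero]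
  simp only [network_sq]
  rw [integral_const_mul, integral_finsetSum _ fun r _ => integrable_finsetSum _ fun s _ =>
    integrable_network_term v r s]
  calc (1 / (m : ℝ)) * ∑ r, ∫ p, ∑ s, (relu (inner ℝ (p.1 r) v) * relu (inner ℝ (p.1 s) v)) *
        (p.2 r * p.2 s) ∂(initLaw d m)
      ≤ (1 / (m : ℝ)) * ∑ r : Fin m, 1 := by
        refine mul_le_mul_of_nonneg_left (Finset.sum_le_sum fun r _ => ?_) (by positivity)
        rw [integral_finsetSum _ fun s _ => integrable_network_term v r s]
        exact (Finset.sum_le_sum fun s _ => hterm r s).trans_eq (by simp)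
    _ = 1 := by simp [hm']

end Network

section Gram

/-- The product of the activations of two inputs, weighted by their inner product. -/
noncomputable def activationProduct (x : Fin n → EuclideanSpace ℝ (Fin d)) (i j : Fin n)
    (w : EuclideanSpace ℝ (Fin d)) : ℝ :=
  step (inner ℝ w (x i)) * step (inner ℝ w (x j)) * inner ℝ (x i) (x j)

theorem measurable_step : Measurable step := measurable_const.indicator measurableSet_Ici

theorem measurable_activationProduct (i j : Fin n) : Measurable (activationProduct x i j) := by
  have h : ∀ i, Measurable fun w : EuclideanSpace ℝ (Fin d) => step (inner ℝ w (x i)) := fun i =>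
    measurable_step.comp (by fun_prop)
  exact ((h i).mul (h j)).mul_const _

theorem abs_activationProduct_le (hx : ∀ i, ‖x i‖ = 1) (i j : Fin n)
    (w : EuclideanSpace ℝ (Fin d)) : |activationProduct x i j w| ≤ 1 := by
  have hin : |(inner ℝ (x i) (x j) : ℝ)| ≤ 1 := by
    simpa [hx] using abs_real_inner_le_norm (x i) (x j)
  rw [activationProduct, abs_mul, abs_mul, abs_of_nonneg (step_nonneg _),
    abs_of_nonneg (step_nonneg _)]
  exact mul_le_one₀ (mul_le_one₀ (step_le_one _) (step_nonneg _) (step_le_one _))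
    (abs_nonneg _) hin

theorem gramInfinity_apply (i j : Fin n) : gramInfinity x i j =
    ∫ w, activationProduct x i j w ∂(stdGaussian (EuclideanSpace ℝ (Fin d))) := by
  refine integral_congr_ae (ae_of_all _ fun w => ?_)
  by_cases hi : 0 ≤ (inner ℝ w (x i) : ℝ) <;> by_cases hj : 0 ≤ (inner ℝ w (x j) : ℝ) <;>
    simp [activationProduct, step, indicator, hi, hj]

theorem isHermitian_gramInfinity : (gramInfinity x).IsHermitian := by
  ext i j
  rw [Matrix.conjTranspose_apply, star_trivial, gramInfinity_apply, gramInfinity_apply]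
  refine integral_congr_ae (ae_of_all _ fun w => ?_)
  simp only [activationProduct]
  rw [real_inner_comm (x i) (x j)]
  ring

theorem gramInfinity_diag_le (hx : ∀ i, ‖x i‖ = 1) (i : Fin n) : gramInfinity x i i ≤ 1 := by
  rw [gramInfinity_apply]
  have h := norm_integral_le_of_norm_le_const (μ := stdGaussian (EuclideanSpace ℝ (Fin d)))
    (ae_of_all _ fun w => (Real.norm_eq_abs _).trans_le (abs_activationProduct_le hx i i w))
  simp only [probReal_univ, mul_one] at h
  exact (le_abs_self _).trans h

/-- The squared Frobenius distance between the Gram matrix at initialization and its mean. -/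
noncomputable def gramError (x : Fin n → EuclideanSpace ℝ (Fin d))
    (w : Fin m → EuclideanSpace ℝ (Fin d)) : ℝ :=
  ∑ i, ∑ j, (activationGram x (fun i r => step (inner ℝ (w r) (x i))) i j - gramInfinity x i j) ^ 2

theorem gramError_nonneg (w : Fin m → EuclideanSpace ℝ (Fin d)) : 0 ≤ gramError x w :=
  Finset.sum_nonneg fun _ _ => Finset.sum_nonneg fun _ _ => sq_nonneg _

theorem measurable_sampleMean_sub_sq (i j : Fin n) (c : ℝ) :
    Measurable fun w : Fin m → EuclideanSpace ℝ (Fin d) =>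
      ((1 / (m : ℝ)) * ∑ r, activationProduct x i j (w r) - c) ^ 2 :=
  (((Finset.measurable_sum _ fun r _ => (measurable_activationProduct i j).comp
    (measurable_pi_apply r)).const_mul _).sub_const _).pow_const 2

theorem abs_sampleMean_le {f : Fin m → ℝ} (hf : ∀ r, |f r| ≤ 1) :
    |(1 / (m : ℝ)) * ∑ r, f r| ≤ 1 := by
  rw [abs_mul, abs_of_nonneg (by positivity), one_div_mul_eq_div]
  refine div_le_one_of_le₀ ((Finset.abs_sum_le_sum_abs _ _).trans ?_) (Nat.cast_nonneg m)
  exact (Finset.sum_le_sum fun r _ => hf r).trans_eq (by simp)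

theorem integrable_gramError_term (hx : ∀ i, ‖x i‖ = 1) (i j : Fin n) (c : ℝ) :
    Integrable (fun w : Fin m → EuclideanSpace ℝ (Fin d) =>
      ((1 / (m : ℝ)) * ∑ r, activationProduct x i j (w r) - c) ^ 2)
      (Measure.pi fun _ => stdGaussian (EuclideanSpace ℝ (Fin d))) := by
  refine Integrable.of_bound (measurable_sampleMean_sub_sq i j c).aestronglyMeasurable
    ((1 + |c|) ^ 2) (ae_of_all _ fun w => ?_)
  rw [Real.norm_eq_abs, abs_pow]
  refine pow_le_pow_left₀ (abs_nonneg _) ((abs_sub _ _).trans (add_le_add_left ?_ _)) 2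
  exact abs_sampleMean_le fun r => abs_activationProduct_le hx i j (w r)

theorem integrable_gramError (hx : ∀ i, ‖x i‖ = 1) :
    Integrable (fun w : Fin m → EuclideanSpace ℝ (Fin d) => gramError x w)
      (Measure.pi fun _ => stdGaussian (EuclideanSpace ℝ (Fin d))) :=
  integrable_finsetSum _ fun i _ => integrable_finsetSum _ fun j _ =>
    integrable_gramError_term hx i j _

theorem integral_gramError_le (hx : ∀ i, ‖x i‖ = 1) (hm : 0 < m) :
    ∫ w, gramError x w ∂(Measure.pi fun _ : Fin m => stdGaussian (EuclideanSpace ℝ (Fin d))) ≤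
      (n : ℝ) ^ 2 / m := by
  have hint := fun i j => integrable_gramError_term (m := m) hx i j (gramInfinity x i j)
  -- Each entry at initialization is a sample mean of `activationProduct`, with expectation the
  -- entry of `H^∞`; its variance is at most `1 / m`.
  change ∫ w : Fin m → EuclideanSpace ℝ (Fin d), ∑ i, ∑ j, ((1 / (m : ℝ)) *
    ∑ r, activationProduct x i j (w r) - gramInfinity x i j) ^ 2 ∂_ ≤ _
  rw [integral_finsetSum _ fun i _ => integrable_finsetSum _ fun j _ =>
    hint i j]
  calc _ ≤ ∑ i : Fin n, ∑ j : Fin n, 1 / (m : ℝ) := by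
        refine Finset.sum_le_sum fun i _ => ?_
        rw [integral_finsetSum _ fun j _ => hint i j]
        refine Finset.sum_le_sum fun j _ => ?_
        rw [gramInfinity_apply]
        exact integral_sampleMean_sub_sq_le hm (measurable_activationProduct i j)
          (abs_activationProduct_le hx i j)
    _ = (n : ℝ) ^ 2 / m := by simp; ring

/-- If the Gram matrix at initialization is close to its mean then it is positive definite. -/
theorem quadraticForm_ge_of_gramError_le {w : Fin m → EuclideanSpace ℝ (Fin d)} {ε : ℝ}
    (hε : 0 ≤ ε) (h : n ^ 2 * gramError x w ≤ ε ^ 2) (v : Fin n → ℝ) :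
    (leastEigenvalue (gramInfinity x) - ε) * ∑ i, v i ^ 2 ≤
      ∑ i, ∑ j, v i * v j * activationGram x (fun i r => step (inner ℝ (w r) (x i))) i j := by
  have h1 := leastEigenvalue_mul_le (isHermitian_gramInfinity (x := x)) v
  have h2 := quadraticForm_sub_le (gramInfinity x)
    (activationGram x (fun i r => step (inner ℝ (w r) (x i)))) v
  have h3 : ∑ i, ∑ j, |gramInfinity x i j -
      activationGram x (fun i r => step (inner ℝ (w r) (x i))) i j| ≤ ε := by
    -- Cauchy–Schwarz over the `n ^ 2` entries passes from the Frobenius to the entrywise `ℓ¹`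
    -- distance, whence the factor `n ^ 2` in `h`.
    refine le_of_sq_le_sq (le_trans ?_ h) hε
    simp only [gramError, ← Finset.sum_product', Finset.univ_product_univ]
    refine sq_sum_le_card_mul_sum_sq.trans_eq ?_
    simp only [sq_abs, Finset.card_univ, Fintype.card_prod, Fintype.card_fin, ← sq, Nat.cast_pow]
    congr 1
    exact Finset.sum_congr rfl fun q _ => by ring
  have h4 := mul_le_mul_of_nonneg_right h3
    (Finset.sum_nonneg fun i (_ : i ∈ Finset.univ) => sq_nonneg (v i))
  linarith

end Gram

section NearZero

theorem integrable_nearZero (R : ℝ) (v : EuclideanSpace ℝ (Fin d)) :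
    Integrable (fun w => nearZero R (inner ℝ w v)) (stdGaussian (EuclideanSpace ℝ (Fin d))) := by
  have hm : Measurable (nearZero R) := measurable_const.indicator measurableSet_Icc
  refine Integrable.of_bound (hm.comp (by fun_prop)).aestronglyMeasurable 1 (ae_of_all _ fun w => ?_)
  rw [Real.norm_of_nonneg (nearZero_nonneg _ _)]
  exact indicator_le' (fun _ _ => le_rfl) (fun _ _ => zero_le_one) _

theorem integrable_sum_nearZero (R : ℝ) :
    Integrable (fun w : Fin m → EuclideanSpace ℝ (Fin d) =>
      ∑ i, ∑ r, nearZero R (inner ℝ (w r) (x i)))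
      (Measure.pi fun _ => stdGaussian (EuclideanSpace ℝ (Fin d))) :=
  integrable_finsetSum _ fun i _ => integrable_finsetSum _ fun r _ =>
    integrable_comp_eval_const (integrable_nearZero R (x i)) r

theorem integral_sum_nearZero_le (hx : ∀ i, ‖x i‖ = 1) {R : ℝ} (hR : 0 ≤ R) :
    ∫ w, ∑ i, ∑ r, nearZero R (inner ℝ (w r) (x i))
      ∂(Measure.pi fun _ : Fin m => stdGaussian (EuclideanSpace ℝ (Fin d))) ≤ n * m * R := by
  rw [integral_finsetSum _ fun i _ => integrable_finsetSum _ fun r _ =>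
    integrable_comp_eval_const (integrable_nearZero R (x i)) r]
  calc _ ≤ ∑ i : Fin n, ∑ r : Fin m, R := by
        refine Finset.sum_le_sum fun i _ => ?_
        rw [integral_finsetSum _ fun r _ =>
          integrable_comp_eval_const (integrable_nearZero R (x i)) r]
        refine Finset.sum_le_sum fun r _ => ?_
        rw [integral_comp_eval_const (g := fun w => nearZero R (inner ℝ w (x i)))
          (integrable_nearZero R (x i)).aestronglyMeasurable]
        exact integral_nearZero_inner_le (hx i) hR
    _ = n * m * R := by simp; ring

end NearZero

end TwoLayerReLU

/-! ### The good event and the choice of constants. -/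

theorem exists_measurableSet_subset_of_measure_compl_le {Ω : Type*} [MeasurableSpace Ω]
    {μ : Measure Ω} [IsProbabilityMeasure μ] {B : Set Ω} {η : ℝ}
    (hη : 0 ≤ η) (h : μ Bᶜ ≤ ENNReal.ofReal η) :
    ∃ E, E ⊆ B ∧ MeasurableSet E ∧ ENNReal.ofReal (1 - η) ≤ μ E := by
  -- A measurable hull of the bad set has the same measure, so measurability of `B` need not be
  -- proved.
  refine ⟨(toMeasurable μ Bᶜ)ᶜ, compl_subset_comm.1 (subset_toMeasurable μ _),
    (measurableSet_toMeasurable μ _).compl, ?_⟩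
  rw [prob_compl_eq_one_sub (measurableSet_toMeasurable μ _), measure_toMeasurable]
  rw [ENNReal.ofReal_sub _ hη, ENNReal.ofReal_one]
  exact tsub_le_tsub_left h 1

namespace TwoLayerReLU

variable {n d m : ℕ} {x : Fin n → EuclideanSpace ℝ (Fin d)} {y : EuclideanSpace ℝ (Fin n)}

theorem norm_prediction_sub_sq_le_of_abs_le {C : ℝ} (hy : ∀ i, |y i| ≤ C) (a : Fin m → ℝ)
    (w : Fin m → EuclideanSpace ℝ (Fin d)) :
    ‖prediction x a w - y‖ ^ 2 ≤ 2 * ∑ i, network w a (x i) ^ 2 + 2 * n * C ^ 2 := by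
  rw [norm_prediction_sub_sq]
  calc ∑ i, (network w a (x i) - y i) ^ 2 ≤ ∑ i, (2 * network w a (x i) ^ 2 + 2 * C ^ 2) := by
        refine Finset.sum_le_sum fun i _ => ?_
        have h1 : y i ^ 2 ≤ C ^ 2 := sq_le_sq' (abs_le.1 (hy i)).1 (abs_le.1 (hy i)).2
        nlinarith [sq_nonneg (network w a (x i) + y i)]
    _ = _ := by
        rw [Finset.sum_add_distrib, ← Finset.mul_sum]
        simp
        ring

/-- With high probability, the Gram matrix at initialization is close to its mean, the initial
predictions are bounded, few neurons are near an activation boundary, and all signs are `±1`. -/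
theorem initLaw_good_compl_le (hx : ∀ i, ‖x i‖ = 1) (hn : 0 < n) (hm : 0 < m) {lam δ : ℝ}
    (hlam : 0 < lam) (hδ : 0 < δ) (hwidth : 48 * n ^ 4 ≤ m * (lam ^ 2 * δ)) :
    initLaw d m {p | gramError x p.1 < (lam / (4 * n)) ^ 2 ∧
      ∑ i, network p.1 p.2 (x i) ^ 2 < 3 * n / δ ∧
      ∑ i, ∑ r, nearZero (lam * δ / (24 * n ^ 2)) (inner ℝ (p.1 r) (x i)) < m * lam / (8 * n) ∧
      ∀ r, p.2 r ^ 2 = 1}ᶜ ≤ ENNReal.ofReal δ := by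
  have hn' : (0 : ℝ) < n := by exact_mod_cast hn
  have hm' : (0 : ℝ) < m := by exact_mod_cast hm
  -- Each of the three moment conditions may fail with probability `δ / 3`. Here `n ^ 2 / m` fits
  -- because `48 = 16 * 3` in `hwidth`.
  have hgram : ∫ p, gramError x p.1 ∂(initLaw d m) ≤ (lam / (4 * n)) ^ 2 * (δ / 3) := by
    rw [integral_initLaw_fst (fun w => gramError x w)]
    refine (integral_gramError_le hx hm).trans ?_
    rw [div_le_iff₀ hm', div_pow, div_mul_eq_mul_div, div_mul_eq_mul_div, le_div_iff₀ (by positivity)]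
    nlinarith
  have hpred : ∫ p, ∑ i, network p.1 p.2 (x i) ^ 2 ∂(initLaw d m) ≤ 3 * n / δ * (δ / 3) := by
    rw [integral_finsetSum _ fun i _ => integrable_network_sq (x i)]
    refine (Finset.sum_le_sum fun i _ => integral_network_sq_le hm (hx i)).trans_eq ?_
    simp
    field_simp
  -- The margin `R = lam * δ / (24 * n ^ 2)` is chosen so that `n * m * R` equals the right-hand
  -- side exactly.
  have hnear : ∫ p, ∑ i, ∑ r, nearZero (lam * δ / (24 * n ^ 2)) (inner ℝ (p.1 r) (x i))
      ∂(initLaw d m) ≤ m * lam / (8 * n) * (δ / 3) := by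
    rw [integral_initLaw_fst (fun w => ∑ i, ∑ r, nearZero (lam * δ / (24 * n ^ 2))
      (inner ℝ (w r) (x i)))]
    refine (integral_sum_nearZero_le hx (by positivity)).trans_eq ?_
    field_simp
    norm_num
  have h0 : ∀ p : (Fin m → EuclideanSpace ℝ (Fin d)) × (Fin m → ℝ), 0 ≤ gramError x p.1 :=
    fun p => gramError_nonneg p.1
  have h1 := measure_ge_le_of_integral_le h0
    (integrable_initLaw_fst (integrable_gramError hx)) (by positivity) hgram
  have h2 := measure_ge_le_of_integral_le (fun p => Finset.sum_nonneg fun _ _ => sq_nonneg _)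
    (integrable_finsetSum _ fun i _ => integrable_network_sq (x i)) (by positivity) hpred
  have h3 := measure_ge_le_of_integral_le
    (fun p => Finset.sum_nonneg fun _ _ => Finset.sum_nonneg fun _ _ => nearZero_nonneg _ _)
    (integrable_initLaw_fst (f := fun w => ∑ i, ∑ r, nearZero (lam * δ / (24 * n ^ 2))
      (inner ℝ (w r) (x i))) (integrable_sum_nearZero _)) (by positivity) hnear
  have h4 : initLaw d m {p | ∀ r, p.2 r ^ 2 = 1}ᶜ = 0 := ae_initLaw_sq
  refine (measure_mono (t := (({p | (lam / (4 * n)) ^ 2 ≤ gramError x p.1} ∪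
    {p | 3 * n / δ ≤ ∑ i, network p.1 p.2 (x i) ^ 2}) ∪
    {p | m * lam / (8 * n) ≤
      ∑ i, ∑ r, nearZero (lam * δ / (24 * n ^ 2)) (inner ℝ (p.1 r) (x i))}) ∪
    {p | ∀ r, p.2 r ^ 2 = 1}ᶜ) fun p hp => ?_).trans ?_
  · by_contra hne
    simp only [mem_union, mem_ofPred_eq, mem_compl_iff, not_or, not_le, not_not] at hne
    exact hp ⟨hne.1.1.1, hne.1.1.2, hne.1.2, hne.2⟩
  · refine (measure_union_le _ _).trans ?_
    rw [h4, add_zero]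
    refine (measure_union_le _ _).trans
      ((add_le_add ((measure_union_le _ _).trans (add_le_add h1 h2)) h3).trans_eq ?_)
    rw [← ENNReal.ofReal_add (by positivity) (by positivity),
      ← ENNReal.ofReal_add (by positivity) (by positivity)]
    congr 1
    ring

/-- With the prescribed width, the weights move less than the activation margin. -/
theorem weight_bound_lt_margin {N M lam δ C u : ℝ} (hN : 0 < N) (hM : 0 < M) (hlam : 0 < lam)
    (hδ : 0 < δ) (hδ1 : δ ≤ 1) (hu : u ^ 2 ≤ 6 * N / δ + 2 * N * C ^ 2)
    (hwidth : 2304 * (7 + 2 * C ^ 2) * N ^ 6 ≤ M * (lam ^ 4 * δ ^ 3)) :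
    Real.sqrt (N / M) * u * (2 / lam) < lam * δ / (24 * N ^ 2) := by
  refine lt_of_pow_lt_pow_left₀ 2 (by positivity) ?_
  have hu' : u ^ 2 ≤ N * (6 + 2 * C ^ 2) / δ := by
    refine hu.trans ?_
    rw [le_div_iff₀ hδ, add_mul, div_mul_cancel₀ _ hδ.ne']
    nlinarith [mul_nonneg hN.le (sq_nonneg C)]
  calc (Real.sqrt (N / M) * u * (2 / lam)) ^ 2 = N / M * u ^ 2 * (4 / lam ^ 2) := by
        rw [mul_pow, mul_pow, Real.sq_sqrt (by positivity)]; ring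
    _ ≤ N / M * (N * (6 + 2 * C ^ 2) / δ) * (4 / lam ^ 2) := by gcongr
    _ = 4 * N ^ 2 * (6 + 2 * C ^ 2) / (M * δ * lam ^ 2) := by field_simp
    _ < lam ^ 2 * δ ^ 2 / (576 * N ^ 4) := by
        rw [div_lt_div_iff₀ (by positivity) (by positivity)]
        -- The width has `7` where `6` would give only `≤`; the surplus yields the strict
        -- inequality.
        nlinarith [pow_pos hN 6]
    _ = (lam * δ / (24 * N ^ 2)) ^ 2 := by rw [div_pow, mul_pow, mul_pow]; norm_num; ring

end TwoLayerReLU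

theorem theorem3p2 (C : ℝ) :
    ∃ K : ℝ, 0 < K ∧
      ∀ (n d m : ℕ) (x : Fin n → EuclideanSpace ℝ (Fin d)) (y : EuclideanSpace ℝ (Fin n)) (δ : ℝ),
        0 < TwoLayerReLU.leastEigenvalue (TwoLayerReLU.gramInfinity x) →
        (∀ i, ‖x i‖ = 1) →
        (∀ i, |y i| ≤ C) →
        0 < δ →
        K * ((n : ℝ) ^ 6 /
          (TwoLayerReLU.leastEigenvalue (TwoLayerReLU.gramInfinity x) ^ 4 * δ ^ 3)) ≤ (m : ℝ) →
        ∃ E : Set ((Fin m → EuclideanSpace ℝ (Fin d)) × (Fin m → ℝ)),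
          MeasurableSet E ∧
          ENNReal.ofReal (1 - δ) ≤ TwoLayerReLU.initLaw d m E ∧
          ∀ p ∈ E, ∀ W : ℝ → Fin m → EuclideanSpace ℝ (Fin d),
            TwoLayerReLU.IsGradientFlow x y p.2 W → W 0 = p.1 →
            ∀ t : ℝ, 0 ≤ t →
              ‖TwoLayerReLU.prediction x p.2 (W t) - y‖ ^ 2 ≤
                Real.exp (-TwoLayerReLU.leastEigenvalue (TwoLayerReLU.gramInfinity x) * t) *
                  ‖TwoLayerReLU.prediction x p.2 (W 0) - y‖ ^ 2 := by
  open TwoLayerReLU in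
  -- `2304 = 4 * 24 ^ 2`: the `4` is from the squared factor `2 / lam` of the displacement, the `24`
  -- from the margin.
  refine ⟨2304 * (7 + 2 * C ^ 2), by positivity, fun n d m x y δ hlam hx hy hδ hK => ?_⟩
  rcases le_total 1 δ with hδ1 | hδ1
  · exact ⟨∅, MeasurableSet.empty, by rw [ENNReal.ofReal_of_nonpos (by linarith)]; exact zero_le,
      fun p hp => absurd hp (notMem_empty p)⟩
  have hn := pos_of_leastEigenvalue_pos hlam
  -- The bound `λ ≤ 1`, with `δ ≤ 1` and `n ≥ 1`, lets the width for the displacement also cover the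
  -- weaker one for Gram concentration.
  have hlam1 := (leastEigenvalue_le_diag (isHermitian_gramInfinity (x := x)) ⟨0, hn⟩).trans
    (gramInfinity_diag_le hx _)
  set lam := leastEigenvalue (gramInfinity x)
  have hn' : (1 : ℝ) ≤ n := by exact_mod_cast hn
  have hm' : (0 : ℝ) < m := lt_of_lt_of_le (by positivity) hK
  have hm : 0 < m := by exact_mod_cast hm'
  have hwidth : 2304 * (7 + 2 * C ^ 2) * (n : ℝ) ^ 6 ≤ m * (lam ^ 4 * δ ^ 3) := by
    rwa [← mul_div_assoc, div_le_iff₀ (by positivity)] at hK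
  have hwidth' : 48 * (n : ℝ) ^ 4 ≤ m * (lam ^ 2 * δ) := by
    calc 48 * (n : ℝ) ^ 4 ≤ 2304 * (7 + 2 * C ^ 2) * (n : ℝ) ^ 6 :=
          mul_le_mul (by nlinarith [sq_nonneg C]) (pow_le_pow_right₀ hn' (by norm_num))
            (by positivity) (by positivity)
      _ ≤ m * (lam ^ 4 * δ ^ 3) := hwidth
      _ ≤ m * (lam ^ 2 * δ) := by
          refine mul_le_mul_of_nonneg_left (mul_le_mul ?_ ?_ (by positivity) (by positivity))
            hm'.le
          · exact pow_le_pow_of_le_one hlam.le hlam1 (by norm_num)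
          · exact pow_le_of_le_one hδ.le hδ1 (by norm_num)
  obtain ⟨E, hEB, hEm, hE⟩ := exists_measurableSet_subset_of_measure_compl_le hδ.le
    (initLaw_good_compl_le (d := d) hx hn hm hlam hδ hwidth')
  refine ⟨E, hEm, hE, fun p hp W hW h0 t ht => ?_⟩
  obtain ⟨hgram, hpred, hnear, hsign⟩ := hEB hp
  rw [← h0] at hgram hpred hnear
  have hn0 : (n : ℝ) ≠ 0 := by positivity
  refine hW.norm_prediction_sub_sq_le_of_init (R := lam * δ / (24 * n ^ 2)) hx hsign hm hlam
    (fun v => ?_) ?_ ?_ ht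
  · have h := quadraticForm_ge_of_gramError_le (x := x) (w := W 0) (ε := lam / 4) (by positivity)
      (by
        calc (n : ℝ) ^ 2 * gramError x (W 0) ≤ n ^ 2 * (lam / (4 * n)) ^ 2 := by gcongr
          _ = (lam / 4) ^ 2 := by field_simp) v
    rwa [show lam - lam / 4 = 3 / 4 * lam by ring] at h
  · calc _ ≤ 2 * (n : ℝ) * (m * lam / (8 * n)) := by gcongr
      _ = m * (lam / 4) := by field_simp; norm_num
  · refine weight_bound_lt_margin (by positivity) hm' hlam hδ hδ1 ?_ hwidth
    refine (norm_prediction_sub_sq_le_of_abs_le hy _ _).trans ?_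
    rw [show 6 * (n : ℝ) / δ = 2 * (3 * n / δ) by ring]
    gcongr
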